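/- Let $N\ge 1$, let $C_N^A=\{x\in\mathbb R^N: x_1\ge x_2\ge\dots\ge x_N\}$, and let $B=(B_t)_{t\ge 0}$ be an $N$-dimensional Brownian motion with $B_0=0$. Put $H(z)_i=\sum_{j\ne i}\frac1{z_i-z_j}$. Let $x$ be a point in the interior of $C_N^A$, let $y\in\mathbb R^N$, and let $k_0\ge 1/2$ be such that $\sqrt k\,x+y$ lies in the interior of $C_N^A$ for all $k\ge k_0$. Let $\phi(\cdot,x):[0,\infty)\to \operatorname{int} C_N^A$ be the solution of $\frac{d}{dt}\phi(t,x)=H(\phi(t,x))$, $\phi(0,x)=x$. For $k\ge k_0$ let $(X_{t,k})_{t\ge 0}$ be the Bessel process of type $A_{N-1}$ with multiplicity $k$ started at $\sqrt k\,x+y$ and driven by $B$, i.e. the $C_N^A$-valued continuous process, with almost surely locally integrable drift, that almost surely solves $$X_{t,k}=\sqrt k\,x+y+B_t+k\int_0^t H(X_{s,k})\,ds\qquad(t\ge 0)$$ (in particular almost surely $X_{s,k}$ is in the interior of $C_N^A$ for Lebesgue-almost every $s$). The same $B$ is used for all $k$, and versions are chosen such that almost surely $k\mapsto X_{t,k}$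 is continuous on $[k_0,\infty)$ for every $t\ge 0$. Let $(W_t)_{t\ge 0}$ be the continuous solution of the linear SDE $$dW_t=dB_t+A(t,x)W_t\,dt,\qquad W_0=y,$$ where $A(t,x)_{i,j}=\frac{1}{(\phi_i(t,x)-\phi_j(t,x))^2}$ for $i\ne j$ and $A(t,x)_{i,i}=-\sum_{j\ne i}\frac{1}{(\phi_i(t,x)-\phi_j(t,x))^2}$. Then, for every $t>0$, $$\sup_{0\le s\le t,\;k\ge k_0}\sqrt k\,\bigl\|X_{s,k}-\sqrt k\,\phi(s,x)-W_s\bigr\|<\infty\qquad\text{almost surely.}$$ That is, almost surely, $\sqrt k\bigl(\frac{X_{t,k}}{\sqrt k}-\phi(t,x)\bigr)\to W_t$ as $k\to\infty$, locally uniformly in $t\in[0,\infty)$, with rate $O(1/\sqrt k)$: almost surely, for every $t>0$ there is $C<\infty$ (depending on $t$ and the realization) such that for all $k\ge k_0$ $$\sup_{0\le s\le t}\Bigl\|\sqrt k\Bigl(\frac{X_{s,k}}{\sqrt k}-\phi(s,x)\Bigr)-W_s\Bigr\|\le \frac{C}{\sqrt k}.$$ -/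

import Mathlib

open MeasureTheory ProbabilityTheory Filter Topology
open scoped NNReal

namespace BesselA

/-- The closed Weyl chamber `x₁ ≥ x₂ ≥ … ≥ x_N` of type `A_{N-1}`. -/
def weylChamber (N : ℕ) : Set (EuclideanSpace ℝ (Fin N)) :=
  {x | ∀ i j : Fin N, i ≤ j → x j ≤ x i}

/-- The interior of the Weyl chamber is given by the strict inequalities. -/
theorem mem_interior_weylChamber {N : ℕ} {x : EuclideanSpace ℝ (Fin N)} :
    x ∈ interior (weylChamber N) ↔ ∀ i j : Fin N, i < j → x j < x i := by
  constructor
  · intro hx i j hij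
    have hc : Continuous fun t : ℝ => x - t • EuclideanSpace.single i (1 : ℝ) := by fun_prop
    have h0 : ∀ᶠ t in 𝓝 (0 : ℝ),
        x - t • EuclideanSpace.single i (1 : ℝ) ∈ interior (weylChamber N) := by
      apply hc.continuousAt.eventually_mem
      simpa using isOpen_interior.mem_nhds hx
    have h1 : ∀ᶠ t in 𝓝[>] (0 : ℝ),
        x - t • EuclideanSpace.single i (1 : ℝ) ∈ interior (weylChamber N) :=
      h0.filter_mono nhdsWithin_le_nhds
    obtain ⟨t, ht, htpos⟩ := (h1.and self_mem_nhdsWithin).exists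
    have h2 := interior_subset ht i j hij.le
    have hne : j ≠ i := hij.ne'
    simp [hne] at h2
    have : (0 : ℝ) < t := htpos
    linarith
  · intro hx
    have hopen : IsOpen {z : EuclideanSpace ℝ (Fin N) | ∀ i j : Fin N, i < j → z j < z i} := by
      simp only [Set.ofPred_forall]
      refine isOpen_iInter_of_finite fun i => isOpen_iInter_of_finite fun j =>
        isOpen_iInter_of_finite fun _ => isOpen_lt (by fun_prop) (by fun_prop)
    refine interior_maximal ?_ hopen hx
    intro z hz i j hij
    rcases hij.lt_or_eq with h | h
    · exact (hz i j h).le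
    · rw [h]

/-- The vector field `H(x)ᵢ = ∑_{j ≠ i} 1 / (xᵢ - xⱼ)`. -/
noncomputable def H {N : ℕ} (x : EuclideanSpace ℝ (Fin N)) : EuclideanSpace ℝ (Fin N) :=
  WithLp.toLp 2 fun i => ∑ j ∈ Finset.univ.erase i, 1 / (x i - x j)

/-- `φ`, restricted to `[0, ∞)`, is the solution of `dφ/dt = H(φ)`, `φ(0) = x`, in the interior
of the Weyl chamber (at `t = 0` the derivative is one-sided). -/
structure IsLimitFlow {N : ℕ} (x : EuclideanSpace ℝ (Fin N))
    (φ : ℝ → EuclideanSpace ℝ (Fin N)) : Prop where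
  init : φ 0 = x
  mem_interior : ∀ t : ℝ, 0 ≤ t → φ t ∈ interior (weylChamber N)
  hasDeriv : ∀ t : ℝ, 0 ≤ t → HasDerivWithinAt φ (H (φ t)) (Set.Ici 0) t

/-- The matrix with off-diagonal entries `1 / (pᵢ - pⱼ)²` and
diagonal entries `-∑_{j ≠ i} 1 / (pᵢ - pⱼ)²`. -/
noncomputable def A {N : ℕ} (p : EuclideanSpace ℝ (Fin N)) : Matrix (Fin N) (Fin N) ℝ :=
  Matrix.of fun i j =>
    if i = j then -∑ l ∈ Finset.univ.erase i, 1 / (p i - p l) ^ 2 else 1 / (p i - p j) ^ 2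

/-- `N`-dimensional Brownian motion started at `0`: the coordinate processes are independent
real Brownian motions (with almost surely continuous paths). -/
structure IsBrownian {Ω : Type*} [MeasurableSpace Ω] {N : ℕ}
    (B : ℝ≥0 → Ω → EuclideanSpace ℝ (Fin N)) (P : Measure Ω) : Prop where
  coord : ∀ i : Fin N, IsBrownianReal (fun t ω => B t ω i) P
  indep : iIndepFun (fun (i : Fin N) (ω : Ω) (t : ℝ≥0) => B t ω i) P

/-- The path `X` solves `dX = db + k H(X) dt`, `X₀ = x₀`, in the closed Weyl chamber, driven by
the path `b`. The drift `H(X)` is infinite on the boundary of the chamber, hence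
boundary times form a Lebesgue null set and the drift is locally integrable.
Avoidance of the boundary at all times is not part of the definition. -/
structure IsBesselPath {N : ℕ} (k : ℝ) (x₀ : EuclideanSpace ℝ (Fin N))
    (b X : ℝ≥0 → EuclideanSpace ℝ (Fin N)) : Prop where
  continuous : Continuous X
  mem_chamber : ∀ t : ℝ≥0, X t ∈ weylChamber N
  ae_mem_interior : ∀ᵐ s : ℝ, 0 ≤ s → X s.toNNReal ∈ interior (weylChamber N)
  integrable : ∀ t : ℝ≥0, IntervalIntegrable (fun s : ℝ => H (X s.toNNReal)) volume 0 t
  equation : ∀ t : ℝ≥0, X t = x₀ + b t + k • ∫ s in (0 : ℝ)..t, H (X s.toNNReal)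

/-- The path `W` solves the linear equation `dW = db + A(φ(t)) W dt`, `W₀ = y`, driven by the
path `b`. -/
structure IsLinearPath {N : ℕ} (φ : ℝ → EuclideanSpace ℝ (Fin N)) (y : EuclideanSpace ℝ (Fin N))
    (b W : ℝ≥0 → EuclideanSpace ℝ (Fin N)) : Prop where
  continuous : Continuous W
  equation : ∀ t : ℝ≥0, W t = y + b t +
    ∫ s in (0 : ℝ)..t, WithLp.toLp 2 ((A (φ s)).mulVec (WithLp.ofLp (W s.toNNReal)))

end BesselA

/-! The argument is pathwise. The path V = √k φ + W has the same noise and the same starting point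
as X_k, so X_k - V is an indefinite integral and ordinary calculus applies. Its integrand splits as
k(H(X) - H(V)) plus the defect kH(V) - √k H(φ) - A(φ)W. Since H is monotone decreasing on the open
chamber (`inner_H_sub_nonpos`), the first part never increases |X - V|; singular times of X form a
null set and do no harm. Hence |X - V| is bounded by the accumulated defect
(`IsBesselPath.norm_sub_le`). As H is homogeneous of degree -1 and A is its Jacobian, the defect is
O(1/√k) wherever W is small against the gaps of √k φ (`norm_H_taylor_le`).

On a compact time interval the gaps of φ are bounded below and W is bounded, so this covers all
large k. The remaining k lie in a bounded range, where comparison with a single fixed path gives a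
crude uniform bound. -/

namespace BesselA

/-! ### Energy estimates for indefinite integrals -/

/-- Chain rule for the square of an indefinite integral. -/
lemma sq_add_integral {c T : ℝ} {g : ℝ → ℝ} (hg : IntervalIntegrable g volume 0 T) :
    (c + ∫ r in (0 : ℝ)..T, g r) ^ 2 =
      c ^ 2 + ∫ s in (0 : ℝ)..T, 2 * (g s * (c + ∫ r in (0 : ℝ)..s, g r)) := by
  -- As `g` is only integrable, the primitive is differentiable merely almost everywhere; absolute
  -- continuity is what justifies integration by parts.
  have hac : AbsolutelyContinuousOnInterval (fun s => c + ∫ r in (0 : ℝ)..s, g r) 0 T := by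
    refine AbsolutelyContinuousOnInterval.add ?_
      (hg.absolutelyContinuousOnInterval_intervalIntegral (c := 0) (by simp))
    exact (LipschitzWith.const c).lipschitzOnWith.absolutelyContinuousOnInterval
  have h := hac.integral_deriv_mul_eq_sub hac
  simp only [intervalIntegral.integral_same, add_zero] at h
  have h2 : ∫ s in (0 : ℝ)..T, 2 * (g s * (c + ∫ r in (0 : ℝ)..s, g r)) =
      (c + ∫ r in (0 : ℝ)..T, g r) * (c + ∫ r in (0 : ℝ)..T, g r) - c * c := by
    rw [← h]
    apply intervalIntegral.integral_congr_ae
    filter_upwards [hg.ae_hasDerivAt_integral] with s hs hsm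
    rw [((hs (Set.uIoc_subset_uIcc hsm) 0 (by simp)).const_add c).deriv]
    ring
  rw [h2]
  ring

variable {N : ℕ}

lemma integral_apply {f : ℝ → EuclideanSpace ℝ (Fin N)} {T : ℝ}
    (hf : IntervalIntegrable f volume 0 T) (i : Fin N) :
    (∫ s in (0 : ℝ)..T, f s) i = ∫ s in (0 : ℝ)..T, f s i :=
  ((EuclideanSpace.proj (𝕜 := ℝ) i).intervalIntegral_comp_comm hf).symm

lemma intervalIntegrable_apply {f : ℝ → EuclideanSpace ℝ (Fin N)} {a b : ℝ}
    (hf : IntervalIntegrable f volume a b) (i : Fin N) :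
    IntervalIntegrable (fun s => f s i) volume a b :=
  ⟨(EuclideanSpace.proj (𝕜 := ℝ) i).integrable_comp hf.1,
    (EuclideanSpace.proj (𝕜 := ℝ) i).integrable_comp hf.2⟩

/-- Chain rule for the squared norm of an indefinite integral. -/
lemma norm_sq_add_integral {d : EuclideanSpace ℝ (Fin N)} {T : ℝ}
    {f : ℝ → EuclideanSpace ℝ (Fin N)} (hf : IntervalIntegrable f volume 0 T) :
    IntervalIntegrable (fun s => 2 * inner ℝ (f s) (d + ∫ r in (0 : ℝ)..s, f r)) volume 0 T ∧
    ‖d + ∫ r in (0 : ℝ)..T, f r‖ ^ 2 =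
      ‖d‖ ^ 2 + ∫ s in (0 : ℝ)..T, 2 * inner ℝ (f s) (d + ∫ r in (0 : ℝ)..s, f r) := by
  have hfi := intervalIntegrable_apply hf
  have hsub : ∀ s ∈ Set.uIcc 0 T, IntervalIntegrable f volume 0 s := fun s hs =>
    hf.mono_set (Set.uIcc_subset_uIcc (by simp) hs)
  have hint : ∀ i, IntervalIntegrable
      (fun s => 2 * (f s i * (d i + ∫ r in (0 : ℝ)..s, f r i))) volume 0 T := by
    intro i
    refine ((hfi i).mul_continuousOn ?_).const_mul 2
    exact continuousOn_const.add (intervalIntegral.continuousOn_primitive_interval'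
      (hfi i) (by simp))
  have hcongr : ∀ s ∈ Set.uIcc 0 T, ∑ i, 2 * (f s i * (d i + ∫ r in (0 : ℝ)..s, f r i)) =
      2 * inner ℝ (f s) (d + ∫ r in (0 : ℝ)..s, f r) := by
    intro s hs
    rw [PiLp.inner_apply, Finset.mul_sum]
    refine Finset.sum_congr rfl fun i _ => ?_
    simp only [PiLp.add_apply, integral_apply (hsub s hs), RCLike.inner_apply, conj_trivial]
    ring
  constructor
  · refine IntervalIntegrable.congr ?_ (IntervalIntegrable.sum Finset.univ fun i _ => hint i)
    intro s hs
    simpa using hcongr s (Set.uIoc_subset_uIcc hs)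
  · rw [EuclideanSpace.real_norm_sq_eq, EuclideanSpace.real_norm_sq_eq,
      ← intervalIntegral.integral_congr hcongr,
      intervalIntegral.integral_finsetSum fun i _ => hint i, ← Finset.sum_add_distrib]
    refine Finset.sum_congr rfl fun i _ => ?_
    rw [← sq_add_integral (hfi i), PiLp.add_apply, integral_apply hf]

/-- If a path moves away from the origin with radial speed at most `C`, its norm grows at most
linearly. -/
lemma norm_add_integral_le {d : EuclideanSpace ℝ (Fin N)} {T C : ℝ} (hT : 0 ≤ T) (hC : 0 ≤ C)
    {f : ℝ → EuclideanSpace ℝ (Fin N)} (hf : IntervalIntegrable f volume 0 T)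
    (h : ∀ᵐ s, s ∈ Set.Icc 0 T → inner ℝ (f s) (d + ∫ r in (0 : ℝ)..s, f r) ≤
      C * ‖d + ∫ r in (0 : ℝ)..s, f r‖) {s : ℝ} (hs : s ∈ Set.Icc 0 T) :
    ‖d + ∫ r in (0 : ℝ)..s, f r‖ ≤ ‖d‖ + 2 * C * T := by
  have hcont : ContinuousOn (fun s => ‖d + ∫ r in (0 : ℝ)..s, f r‖) (Set.Icc 0 T) := by
    rw [← Set.uIcc_of_le hT]
    exact (continuousOn_const.add
      (intervalIntegral.continuousOn_primitive_interval' hf (by simp))).norm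
  -- At a maximum M of the norm the energy identity gives M² ≤ ‖d‖² + 2CTM, which forces M ≤ ‖d‖ +
  -- 2CT without Gronwall.
  obtain ⟨m, hm, hmax⟩ := isCompact_Icc.exists_isMaxOn ⟨0, by simp [hT]⟩ hcont
  refine (hmax hs).trans ?_
  set M := ‖d + ∫ r in (0 : ℝ)..m, f r‖ with hM
  have hM0 : 0 ≤ M := norm_nonneg _
  have hfm : IntervalIntegrable f volume 0 m := hf.mono_set (by
    rw [Set.uIcc_of_le hm.1, Set.uIcc_of_le hT]; exact Set.Icc_subset_Icc_right hm.2)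
  obtain ⟨hi, he⟩ := norm_sq_add_integral (d := d) hfm
  have hle : ∫ s in (0 : ℝ)..m, 2 * inner ℝ (f s) (d + ∫ r in (0 : ℝ)..s, f r) ≤
      ∫ s in (0 : ℝ)..m, 2 * (C * M) := by
    refine intervalIntegral.integral_mono_ae_restrict hm.1 hi (by simp) ?_
    filter_upwards [ae_restrict_of_ae h, ae_restrict_mem measurableSet_Icc] with s hs hsm
    have hsT : s ∈ Set.Icc 0 T := ⟨hsm.1, hsm.2.trans hm.2⟩
    have h1 : ‖d + ∫ r in (0 : ℝ)..s, f r‖ ≤ M := hmax hsT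
    have := mul_le_mul_of_nonneg_left h1 hC
    linarith [hs hsT]
  rw [intervalIntegral.integral_const, sub_zero, smul_eq_mul] at hle
  rw [← hM] at he
  have h2 : m * (2 * (C * M)) ≤ T * (2 * (C * M)) :=
    mul_le_mul_of_nonneg_right hm.2 (by positivity)
  by_contra hcon
  push Not at hcon
  have h3 := norm_nonneg d
  have h4 : 0 ≤ C * T := by positivity
  nlinarith [mul_lt_mul_of_pos_left hcon (by linarith : 0 < M)]

/-! ### Monotonicity of the drift and pathwise comparison -/

lemma H_apply (p : EuclideanSpace ℝ (Fin N)) (i : Fin N) :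
    H p i = ∑ j ∈ Finset.univ.erase i, 1 / (p i - p j) := rfl

/-- The rows of `A p` sum to zero, so only differences of `w` enter, as in the linearization of `H`.
-/
lemma A_mulVec_apply (p : EuclideanSpace ℝ (Fin N)) (w : Fin N → ℝ) (i : Fin N) :
    (A p).mulVec w i = ∑ j ∈ Finset.univ.erase i, (w j - w i) / (p i - p j) ^ 2 := by
  rw [Matrix.mulVec, dotProduct, ← Finset.add_sum_erase _ _ (Finset.mem_univ i)]
  have h : ∀ j ∈ Finset.univ.erase i, A p i j * w j = w j / (p i - p j) ^ 2 := by
    intro j hj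
    simp [A, (Finset.ne_of_mem_erase hj).symm]
    ring
  rw [Finset.sum_congr rfl h]
  simp only [A, Matrix.of_apply, if_true, neg_mul, Finset.sum_mul, sub_div,
    Finset.sum_sub_distrib]
  simp only [one_div_mul_eq_div]
  ring

/-- The drift `H` is a monotone decreasing operator on the open Weyl chamber. -/
lemma inner_H_sub_nonpos {u v : EuclideanSpace ℝ (Fin N)} (hu : u ∈ interior (weylChamber N))
    (hv : v ∈ interior (weylChamber N)) : inner ℝ (H u - H v) (u - v) ≤ 0 := by
  rw [mem_interior_weylChamber] at hu hv
  let F : Fin N → Fin N → ℝ := fun i j =>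
    if i = j then 0 else 1 / (u i - u j) - 1 / (v i - v j)
  have hF : ∀ i, (H u - H v) i = ∑ j, F i j := by
    intro i
    rw [PiLp.sub_apply, H_apply, H_apply, ← Finset.sum_sub_distrib,
      ← Finset.add_sum_erase _ _ (Finset.mem_univ i)]
    simp only [F, if_true, zero_add]
    refine Finset.sum_congr rfl fun j hj => ?_
    rw [if_neg (Finset.ne_of_mem_erase hj).symm]
  have hanti : ∀ i j, F j i = -F i j := by
    intro i j
    simp only [F, eq_comm (a := j)]
    split_ifs
    · simp
    · rw [← neg_sub (u i), ← neg_sub (v i)]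
      simp only [one_div, inv_neg]
      ring
  have h1 : inner ℝ (H u - H v) (u - v) = ∑ i, ∑ j, F i j * (u i - v i) := by
    rw [PiLp.inner_apply]
    refine Finset.sum_congr rfl fun i _ => ?_
    rw [hF, RCLike.inner_apply, conj_trivial, PiLp.sub_apply, mul_comm, Finset.sum_mul]
  have h2 : ∑ i, ∑ j, F i j * (u i - v i) = -∑ i, ∑ j, F i j * (u j - v j) := by
    rw [Finset.sum_comm, ← Finset.sum_neg_distrib]
    refine Finset.sum_congr rfl fun i _ => ?_
    rw [← Finset.sum_neg_distrib]
    refine Finset.sum_congr rfl fun j _ => ?_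
    rw [hanti i j]
    ring
  -- By antisymmetry of `F` this difference is twice the inner product. Each summand is nonpositive
  -- because the gaps of `u` and `v` have the same sign and 1/r is decreasing on each half-line.
  have h3 : ∑ i, ∑ j, F i j * (u i - v i) - ∑ i, ∑ j, F i j * (u j - v j) ≤ 0 := by
    rw [← Finset.sum_sub_distrib]
    refine Finset.sum_nonpos fun i _ => ?_
    rw [← Finset.sum_sub_distrib]
    refine Finset.sum_nonpos fun j _ => ?_
    by_cases hij : i = j
    · simp [F, hij]
    have hpos : 0 < (u i - u j) * (v i - v j) := by
      rcases lt_or_gt_of_ne hij with h | h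
      · exact mul_pos (sub_pos.2 (hu i j h)) (sub_pos.2 (hv i j h))
      · exact mul_pos_of_neg_of_neg (sub_neg.2 (hu j i h)) (sub_neg.2 (hv j i h))
    have ha : u i - u j ≠ 0 := left_ne_zero_of_mul hpos.ne'
    have hb : v i - v j ≠ 0 := right_ne_zero_of_mul hpos.ne'
    have : F i j * (u i - v i) - F i j * (u j - v j) =
        -(((u i - u j) - (v i - v j)) ^ 2 / ((u i - u j) * (v i - v j))) := by
      simp only [F, if_neg hij]
      field_simp
      ring
    rw [this]
    exact neg_nonpos.2 (div_nonneg (sq_nonneg _) hpos.le)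
  linarith

/-- Comparison of a Bessel path with a path in the open chamber that has the same noise. -/
lemma IsBesselPath.norm_sub_le {k C : ℝ} {T : ℝ≥0} {x₀ v₀ : EuclideanSpace ℝ (Fin N)}
    {b X V : ℝ≥0 → EuclideanSpace ℝ (Fin N)} {g : ℝ → EuclideanSpace ℝ (Fin N)}
    (hX : IsBesselPath k x₀ b X) (hk : 0 ≤ k) (hg : IntervalIntegrable g volume 0 T)
    (hV : ∀ t ≤ T, V t = v₀ + b t + ∫ s in (0 : ℝ)..t, g s)
    (hVint : ∀ t ≤ T, V t ∈ interior (weylChamber N))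
    (hC : ∀ s ∈ Set.Icc (0 : ℝ) T, ‖k • H (V s.toNNReal) - g s‖ ≤ C) {t : ℝ≥0} (ht : t ≤ T) :
    ‖X t - V t‖ ≤ ‖x₀ - v₀‖ + 2 * C * T := by
  have hT : (0 : ℝ) ≤ T := T.2
  have hC0 : 0 ≤ C := (norm_nonneg _).trans (hC 0 ⟨le_rfl, hT⟩)
  have hXi : IntervalIntegrable (fun s : ℝ => k • H (X s.toNNReal)) volume 0 T :=
    (hX.integrable T).smul k
  have heq : ∀ s : ℝ≥0, s ≤ T → (x₀ - v₀) +
      ∫ r in (0 : ℝ)..s, (k • H (X r.toNNReal) - g r) = X s - V s := by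
    intro s hs
    have hss : Set.uIcc (0 : ℝ) s ⊆ Set.uIcc 0 T := by
      rw [Set.uIcc_of_le s.coe_nonneg, Set.uIcc_of_le hT]
      exact Set.Icc_subset_Icc_right (by exact_mod_cast hs)
    rw [intervalIntegral.integral_sub (hXi.mono_set hss) (hg.mono_set hss),
      intervalIntegral.integral_smul, hX.equation s, hV s hs]
    abel
  rw [← heq t ht]
  refine norm_add_integral_le hT hC0 (hXi.sub hg) ?_ ⟨t.2, by exact_mod_cast ht⟩
  filter_upwards [hX.ae_mem_interior] with s hs hsT
  have hsT' : s.toNNReal ≤ T := Real.toNNReal_le_iff_le_coe.2 hsT.2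
  have h1 := heq s.toNNReal hsT'
  rw [Real.coe_toNNReal s hsT.1] at h1
  rw [h1]
  have h2 : k • H (X s.toNNReal) - g s = k • (H (X s.toNNReal) - H (V s.toNNReal)) +
      (k • H (V s.toNNReal) - g s) := by
    rw [smul_sub]
    abel
  rw [h2, inner_add_left, real_inner_smul_left]
  have h3 := mul_nonpos_of_nonneg_of_nonpos hk
    (inner_H_sub_nonpos (hs hsT.1) (hVint _ hsT'))
  have h4 := real_inner_le_norm (k • H (V s.toNNReal) - g s) (X s.toNNReal - V s.toNNReal)
  have h5 := mul_le_mul_of_nonneg_right (hC s hsT) (norm_nonneg (X s.toNNReal - V s.toNNReal))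
  linarith

/-! ### Size and linearization of the drift -/

lemma norm_le_sqrt_mul {v : EuclideanSpace ℝ (Fin N)} {c : ℝ} (hc : 0 ≤ c)
    (h : ∀ i, |v i| ≤ c) : ‖v‖ ≤ √N * c := by
  rw [← abs_of_nonneg (norm_nonneg v), ← abs_of_nonneg (by positivity : 0 ≤ √N * c), ← sq_le_sq,
    EuclideanSpace.real_norm_sq_eq, mul_pow, Real.sq_sqrt N.cast_nonneg]
  calc ∑ i, v i ^ 2 ≤ ∑ _i : Fin N, c ^ 2 :=
        Finset.sum_le_sum fun i _ => sq_le_sq.2 (by rw [abs_of_nonneg hc]; exact h i)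
    _ = N * c ^ 2 := by simp

lemma abs_sum_erase_le {i : Fin N} {f : Fin N → ℝ} {c : ℝ} (hc : 0 ≤ c)
    (h : ∀ j ≠ i, |f j| ≤ c) : |∑ j ∈ Finset.univ.erase i, f j| ≤ N * c := by
  refine (Finset.abs_sum_le_sum_abs _ _).trans ?_
  calc ∑ j ∈ Finset.univ.erase i, |f j| ≤ ∑ j ∈ Finset.univ.erase i, c :=
        Finset.sum_le_sum fun j hj => h j (Finset.ne_of_mem_erase hj)
    _ ≤ ∑ _j : Fin N, c :=
        Finset.sum_le_sum_of_subset_of_nonneg (Finset.subset_univ _) fun _ _ _ => hc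
    _ = N * c := by simp

lemma norm_H_le {p : EuclideanSpace ℝ (Fin N)} {δ : ℝ} (hδ : 0 < δ)
    (hp : ∀ i j, i ≠ j → δ ≤ |p i - p j|) : ‖H p‖ ≤ √N * (N * (1 / δ)) := by
  refine norm_le_sqrt_mul (by positivity) fun i => abs_sum_erase_le (by positivity) fun j hj => ?_
  rw [abs_div, abs_one]
  exact one_div_le_one_div_of_le hδ (hp i j hj.symm)

lemma half_gap_le {q δ M a w : ℝ} (hq : 0 ≤ q) (ha : δ ≤ |a|) (hw : |w| ≤ M)
    (hM : 2 * M ≤ q * δ) : q * δ / 2 ≤ |q * a + w| := by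
  have h1 : |q * a| - |w| ≤ |q * a + w| := by
    simpa using abs_sub_abs_le_abs_sub (q * a) (-w)
  rw [abs_mul, abs_of_nonneg hq] at h1
  have := mul_le_mul_of_nonneg_left ha hq
  linarith

/-- Second order Taylor estimate: `q²H(qp + w) = qH(p) + A(p)w + O(1/q)`. -/
lemma norm_H_taylor_le {p w : EuclideanSpace ℝ (Fin N)} {q δ M : ℝ} (hq : 0 < q) (hδ : 0 < δ)
    (hp : ∀ i j, i ≠ j → δ ≤ |p i - p j|) (hw : ∀ i j, |w i - w j| ≤ M)
    (hM : 2 * M ≤ q * δ) :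
    ‖q ^ 2 • H (q • p + w) - (q • H p + WithLp.toLp 2 ((A p).mulVec (WithLp.ofLp w)))‖ ≤
      √N * (N * (2 * M ^ 2 / δ ^ 3)) / q := by
  rw [mul_div_assoc, mul_div_assoc]
  refine norm_le_sqrt_mul (by positivity) fun i => ?_
  simp only [PiLp.sub_apply, PiLp.add_apply, PiLp.smul_apply, smul_eq_mul, A_mulVec_apply, H_apply,
    Finset.mul_sum]
  rw [← Finset.sum_add_distrib, ← Finset.sum_sub_distrib]
  refine abs_sum_erase_le (by positivity) fun j hj => ?_
  have ha := hp i j hj.symm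
  have hg := half_gap_le hq.le ha (hw i j) hM
  have ha0 : p i - p j ≠ 0 := abs_pos.1 (hδ.trans_le ha)
  have hg0 : q * (p i - p j) + (w i - w j) ≠ 0 :=
    abs_pos.1 ((by positivity : 0 < q * δ / 2).trans_le hg)
  have hsplit : q * p i + w i - (q * p j + w j) = q * (p i - p j) + (w i - w j) := by ring
  have hwneg : w j - w i = -(w i - w j) := by ring
  rw [hsplit, hwneg]
  have hww := hw i j
  generalize p i - p j = a at *
  generalize w i - w j = d at *
  -- The Taylor remainder is an exact rational expression; `half_gap_le` bounds its denominator
  -- below.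
  have : q ^ 2 * (1 / (q * a + d)) - (q * (1 / a) + -d / a ^ 2) =
      d ^ 2 / (a ^ 2 * (q * a + d)) := by
    field_simp
    ring
  rw [this, abs_div, abs_mul, abs_pow, abs_pow]
  calc |d| ^ 2 / (|a| ^ 2 * |q * a + d|) ≤ M ^ 2 / (δ ^ 2 * (q * δ / 2)) := by
        gcongr
    _ = 2 * M ^ 2 / δ ^ 3 / q := by
        field_simp

lemma gap_le_abs {p : EuclideanSpace ℝ (Fin N)} {δ : ℝ} (h : ∀ i j, i < j → δ ≤ p i - p j)
    (i j : Fin N) (hij : i ≠ j) : δ ≤ |p i - p j| := by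
  rcases lt_or_gt_of_ne hij with h' | h'
  · exact (h i j h').trans (le_abs_self _)
  · rw [abs_sub_comm]
    exact (h j i h').trans (le_abs_self _)

/-! ### Regularity of the limit flow and the pathwise bound -/

section LimitFlow

variable {x y : EuclideanSpace ℝ (Fin N)} {φ : ℝ → EuclideanSpace ℝ (Fin N)}
  {b W : ℝ≥0 → EuclideanSpace ℝ (Fin N)}

lemma IsLimitFlow.continuousOn (hφ : IsLimitFlow x φ) : ContinuousOn φ (Set.Ici 0) :=
  fun t ht => (hφ.hasDeriv t ht).continuousWithinAt

lemma IsLimitFlow.sub_ne_zero (hφ : IsLimitFlow x φ) {t : ℝ} (ht : 0 ≤ t) {i j : Fin N}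
    (hij : i ≠ j) : φ t i - φ t j ≠ 0 := by
  have h := mem_interior_weylChamber.1 (hφ.mem_interior t ht)
  rcases lt_or_gt_of_ne hij with h' | h'
  · exact (sub_pos.2 (h i j h')).ne'
  · exact (sub_neg.2 (h j i h')).ne

lemma continuousOn_of_apply {f : ℝ → EuclideanSpace ℝ (Fin N)} {s : Set ℝ}
    (h : ∀ i, ContinuousOn (fun t => f t i) s) : ContinuousOn f s :=
  (PiLp.continuous_toLp 2 _).comp_continuousOn (continuousOn_pi.2 h)

lemma IsLimitFlow.continuousOn_apply (hφ : IsLimitFlow x φ) (i : Fin N) :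
    ContinuousOn (fun t => φ t i) (Set.Ici 0) :=
  (EuclideanSpace.proj (𝕜 := ℝ) i).continuous.comp_continuousOn hφ.continuousOn

lemma IsLimitFlow.continuousOn_H (hφ : IsLimitFlow x φ) :
    ContinuousOn (fun t => H (φ t)) (Set.Ici 0) := by
  refine continuousOn_of_apply fun i => ?_
  simp only [H_apply]
  refine continuousOn_finsetSum _ fun j hj => ?_
  exact continuousOn_const.div ((hφ.continuousOn_apply i).sub (hφ.continuousOn_apply j))
    fun t ht => hφ.sub_ne_zero ht (Finset.ne_of_mem_erase hj).symm

lemma IsLimitFlow.continuousOn_A_mulVec (hφ : IsLimitFlow x φ) (hW : Continuous W) :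
    ContinuousOn (fun s : ℝ => WithLp.toLp 2 ((A (φ s)).mulVec (WithLp.ofLp (W s.toNNReal))))
      (Set.Ici 0) := by
  have hWi : ∀ i, Continuous fun s : ℝ => W s.toNNReal i := fun i =>
    (EuclideanSpace.proj (𝕜 := ℝ) i).continuous.comp (hW.comp continuous_real_toNNReal)
  refine continuousOn_of_apply fun i => ?_
  simp only [A_mulVec_apply]
  refine continuousOn_finsetSum _ fun j hj => ?_
  exact ((hWi j).sub (hWi i)).continuousOn.div
    (((hφ.continuousOn_apply i).sub (hφ.continuousOn_apply j)).pow 2)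
    fun t ht => pow_ne_zero 2 (hφ.sub_ne_zero ht (Finset.ne_of_mem_erase hj).symm)

lemma IsLimitFlow.integral_H (hφ : IsLimitFlow x φ) {t : ℝ} (ht : 0 ≤ t) :
    ∫ s in (0 : ℝ)..t, H (φ s) = φ t - x := by
  rw [← hφ.init]
  refine intervalIntegral.integral_eq_sub_of_hasDeriv_right_of_le ht
    (hφ.continuousOn.mono Set.Icc_subset_Ici_self)
    (fun s hs => (hφ.hasDeriv s hs.1.le).mono (Set.Ioi_subset_Ici hs.1.le)) ?_
  exact (hφ.continuousOn_H.mono Set.Icc_subset_Ici_self).intervalIntegrable_of_Icc ht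

/-- On compact time intervals the gaps of the limit flow are bounded away from zero. -/
lemma IsLimitFlow.exists_gap (hφ : IsLimitFlow x φ) (T : ℝ) :
    ∃ δ > 0, ∀ s ∈ Set.Icc 0 T, ∀ i j, i < j → δ ≤ φ s i - φ s j := by
  -- Working with all small δ treats the finitely many pairs at once, even when there are none.
  have h : ∀ᶠ δ in 𝓝[>] (0 : ℝ), ∀ i j : Fin N, i < j →
      ∀ s ∈ Set.Icc 0 T, δ ≤ φ s i - φ s j := by
    simp only [eventually_all]
    intro i j hij
    obtain ⟨δ, hδ, hle⟩ := isCompact_Icc.exists_forall_le' (s := Set.Icc 0 T) (a := 0)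
      (((hφ.continuousOn_apply i).sub (hφ.continuousOn_apply j)).mono Set.Icc_subset_Ici_self)
      fun s hs => sub_pos.2 (mem_interior_weylChamber.1 (hφ.mem_interior s hs.1) i j hij)
    filter_upwards [Ioo_mem_nhdsGT hδ] with ε hε s hs
    exact hε.2.le.trans (hle s hs)
  obtain ⟨δ, hδ, hpos⟩ := (h.and self_mem_nhdsWithin).exists
  exact ⟨δ, hpos, fun s hs i j hij => hδ i j hij s hs⟩

/-- Pathwise bound for `√k (X_k - √k φ - W)`, uniform in time and in the multiplicity. -/
lemma exists_bound_of_isBesselPath (hφ : IsLimitFlow x φ) (hW : IsLinearPath φ y b W) {k₀ : ℝ}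
    (hk₀ : 0 < k₀) (T : ℝ≥0) :
    ∃ C : ℝ, ∀ k, k₀ ≤ k → ∀ X, IsBesselPath k (√k • x + y) b X → ∀ t ≤ T,
      √k * ‖X t - √k • φ t - W t‖ ≤ C := by
  obtain ⟨δ, hδ, hgap⟩ := hφ.exists_gap T
  obtain ⟨m, hm⟩ := (isCompact_Icc (a := (0 : ℝ≥0)) (b := T)).exists_bound_of_continuousOn
    hW.continuous.continuousOn
  obtain ⟨L, hL⟩ := (isCompact_Icc (a := (0 : ℝ)) (b := T)).exists_bound_of_continuousOn
    (hφ.continuousOn.mono Set.Icc_subset_Ici_self)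
  set M := 2 * m with hM
  have hw : ∀ t ≤ T, ∀ i j, |W t i - W t j| ≤ M := by
    intro t ht i j
    have h1 := (PiLp.norm_apply_le (W t) i).trans (hm t ⟨zero_le, ht⟩)
    have h2 := (PiLp.norm_apply_le (W t) j).trans (hm t ⟨zero_le, ht⟩)
    have h3 := abs_sub (W t i) (W t j)
    rw [Real.norm_eq_abs] at h1 h2
    linarith
  have hM0 : 0 ≤ M := by
    have := (norm_nonneg _).trans (hm 0 ⟨le_rfl, zero_le⟩)
    positivity
  have hL0 : 0 ≤ L := (norm_nonneg _).trans (hL 0 ⟨le_rfl, T.coe_nonneg⟩)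
  let g : ℝ → ℝ → EuclideanSpace ℝ (Fin N) := fun q s =>
    q • H (φ s) + WithLp.toLp 2 ((A (φ s)).mulVec (WithLp.ofLp (W s.toNNReal)))
  -- The scale `q` is decoupled from k: it will be √k for large k and the threshold `Q` otherwise.
  let V : ℝ → ℝ≥0 → EuclideanSpace ℝ (Fin N) := fun q t => q • φ t + W t
  have hiH : ∀ t : ℝ≥0, IntervalIntegrable (fun s => H (φ s)) volume 0 t := fun t =>
    (hφ.continuousOn_H.mono Set.Icc_subset_Ici_self).intervalIntegrable_of_Icc t.coe_nonneg
  have hiA : ∀ t : ℝ≥0, IntervalIntegrable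
      (fun s : ℝ => WithLp.toLp 2 ((A (φ s)).mulVec (WithLp.ofLp (W s.toNNReal)))) volume 0 t :=
    fun t => ((hφ.continuousOn_A_mulVec hW.continuous).mono
      Set.Icc_subset_Ici_self).intervalIntegrable_of_Icc t.coe_nonneg
  have hg : ∀ q, IntervalIntegrable (g q) volume 0 T := fun q => ((hiH T).smul q).add (hiA T)
  have hV : ∀ q, ∀ t ≤ T, V q t = (q • x + y) + b t + ∫ s in (0 : ℝ)..t, g q s := by
    intro q t _
    have h : ∫ s in (0 : ℝ)..t, g q s = q • (φ t - x) +
        ∫ s in (0 : ℝ)..t, WithLp.toLp 2 ((A (φ s)).mulVec (WithLp.ofLp (W s.toNNReal))) := by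
      rw [← hφ.integral_H t.coe_nonneg, ← intervalIntegral.integral_smul]
      exact intervalIntegral.integral_add ((hiH t).smul q) (hiA t)
    simp only [V]
    rw [h, hW.equation t, smul_sub]
    abel
  have hVgap : ∀ q, 0 < q → 2 * M ≤ q * δ → ∀ t ≤ T, ∀ i j, i < j →
      q * δ / 2 ≤ V q t i - V q t j := by
    intro q hq hqM t ht i j hij
    have h1 := hgap t ⟨t.coe_nonneg, by exact_mod_cast ht⟩ i j hij
    have h2 := mul_le_mul_of_nonneg_left h1 hq.le
    have h3 := (abs_le.1 (hw t ht i j)).1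
    simp only [V, PiLp.add_apply, PiLp.smul_apply, smul_eq_mul]
    linarith
  have hVint : ∀ q, 0 < q → 2 * M ≤ q * δ → ∀ t ≤ T, V q t ∈ interior (weylChamber N) := by
    intro q hq hqM t ht
    refine mem_interior_weylChamber.2 fun i j hij => ?_
    have h1 := hVgap q hq hqM t ht i j hij
    have h2 : 0 < q * δ := mul_pos hq hδ
    linarith
  set C₀ := √N * (N * (2 * M ^ 2 / δ ^ 3)) with hC₀
  have hC₀0 : 0 ≤ C₀ := by positivity
  have htaylor : ∀ q, 0 < q → 2 * M ≤ q * δ → ∀ s ∈ Set.Icc (0 : ℝ) T,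
      ‖q ^ 2 • H (V q s.toNNReal) - g q s‖ ≤ C₀ / q := by
    intro q hq hqM s hs
    have := norm_H_taylor_le hq hδ (gap_le_abs (hgap s hs))
      (hw s.toNNReal (Real.toNNReal_le_iff_le_coe.2 hs.2)) hqM
    simpa only [V, g, Real.coe_toNNReal s hs.1] using this
  -- From this scale on, the perturbation W uses at most half of each gap of q φ, so `V q` stays in
  -- the open chamber up to time T.
  set Q := max √k₀ (2 * M / δ) with hQ
  have hQ0 : 0 < Q := lt_max_of_lt_left (Real.sqrt_pos.2 hk₀)
  have hQM : ∀ q, Q ≤ q → 2 * M ≤ q * δ := fun q hq =>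
    (div_le_iff₀ hδ).1 ((le_max_right _ _).trans hq)
  -- The first term bounds (k - Q²)H(V_Q), whose gaps are at least Qδ/2; the second is the Taylor
  -- defect at scale `Q`.
  set C₁ := Q ^ 2 * (√N * (N * (1 / (Q * δ / 2)))) + C₀ / Q with hC₁
  have hC₁0 : 0 ≤ C₁ := by positivity
  refine ⟨max (2 * C₀ * T) (Q * ((Q * ‖x‖ + 2 * C₁ * T) + Q * L)), ?_⟩
  intro k hk X hX t ht
  have hk0 : 0 < k := hk₀.trans_le hk
  have hs0 : 0 < √k := Real.sqrt_pos.2 hk0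
  have hsq : √k ^ 2 = k := Real.sq_sqrt hk0.le
  rcases le_total Q √k with hQk | hkQ
  · refine le_trans ?_ (le_max_left _ _)
    have h := hX.norm_sub_le hk0.le (hg √k) (hV √k) (hVint √k hs0 (hQM _ hQk))
      (by simpa only [hsq] using htaylor √k hs0 (hQM _ hQk)) ht
    rw [sub_self, norm_zero, zero_add] at h
    rw [sub_sub]
    refine (mul_le_mul_of_nonneg_left h hs0.le).trans_eq ?_
    field_simp
  · refine le_trans ?_ (le_max_right _ _)
    have hkQ2 : k ≤ Q ^ 2 := by
      rw [← hsq]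
      gcongr
    have hdrift : ∀ s ∈ Set.Icc (0 : ℝ) T, ‖k • H (V Q s.toNNReal) - g Q s‖ ≤ C₁ := by
      intro s hs
      have h1 : k • H (V Q s.toNNReal) - g Q s = (k - Q ^ 2) • H (V Q s.toNNReal) +
          (Q ^ 2 • H (V Q s.toNNReal) - g Q s) := by
        rw [sub_smul]
        abel
      rw [h1]
      refine (norm_add_le _ _).trans (add_le_add ?_ (htaylor Q hQ0 (hQM _ le_rfl) s hs))
      rw [norm_smul, Real.norm_eq_abs, abs_of_nonpos (by linarith)]
      refine mul_le_mul (by linarith) (norm_H_le (by positivity) (gap_le_abs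
        (hVgap Q hQ0 (hQM _ le_rfl) _ (Real.toNNReal_le_iff_le_coe.2 hs.2)))) (norm_nonneg _)
        (by positivity)
    have h := hX.norm_sub_le hk0.le (hg Q) (hV Q) (hVint Q hQ0 (hQM _ le_rfl)) hdrift ht
    have habs : |√k - Q| ≤ Q := by
      rw [abs_of_nonpos (by linarith)]
      linarith
    have h2 : ‖√k • x + y - (Q • x + y)‖ ≤ Q * ‖x‖ := by
      rw [add_sub_add_right_eq_sub, ← sub_smul, norm_smul, Real.norm_eq_abs]
      gcongr
    have h3 : X t - √k • φ t - W t = (X t - V Q t) - (√k - Q) • φ t := by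
      simp only [V, sub_smul]
      abel
    have h4 : ‖(√k - Q) • φ t‖ ≤ Q * L := by
      rw [norm_smul, Real.norm_eq_abs]
      exact mul_le_mul habs (hL t ⟨t.coe_nonneg, by exact_mod_cast ht⟩) (norm_nonneg _) hQ0.le
    rw [h3]
    refine mul_le_mul hkQ ((norm_sub_le _ _).trans (add_le_add (by linarith) h4))
      (norm_nonneg _) hQ0.le

end LimitFlow

/-! ### Almost sure statements -/

/-- Almost surely, `√k (X_k - √k φ - W)` is bounded on compact time intervals, uniformly in
`k ≥ k₀`: by continuity in `k` it suffices to consider rational `k`. -/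
lemma ae_forall_exists_bound {Ω : Type*} [MeasurableSpace Ω] {P : Measure Ω}
    {B : ℝ≥0 → Ω → EuclideanSpace ℝ (Fin N)} {x y : EuclideanSpace ℝ (Fin N)} {k₀ : ℝ}
    (hk₀ : 0 < k₀) {φ : ℝ → EuclideanSpace ℝ (Fin N)} (hφ : IsLimitFlow x φ)
    {X : ℝ → ℝ≥0 → Ω → EuclideanSpace ℝ (Fin N)}
    (hX : ∀ k : ℝ, k₀ ≤ k →
      ∀ᵐ ω ∂P, IsBesselPath k (√k • x + y) (fun t => B t ω) (fun t => X k t ω))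
    (hXk : ∀ᵐ ω ∂P, ∀ t : ℝ≥0, ContinuousOn (fun k : ℝ => X k t ω) (Set.Ici k₀))
    {W : ℝ≥0 → Ω → EuclideanSpace ℝ (Fin N)}
    (hW : ∀ᵐ ω ∂P, IsLinearPath φ y (fun t => B t ω) (fun t => W t ω)) :
    ∀ᵐ ω ∂P, ∀ T : ℝ≥0, ∃ C : ℝ, ∀ k, k₀ ≤ k → ∀ t ≤ T,
      √k * ‖X k t ω - √k • φ t - W t ω‖ ≤ C := by
  have hX' : ∀ᵐ ω ∂P, ∀ r : ℚ, k₀ < r →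
      IsBesselPath (r : ℝ) (√(r : ℝ) • x + y) (fun t => B t ω) (fun t => X r t ω) := by
    rw [ae_all_iff]
    intro r
    by_cases hr : k₀ < r
    · filter_upwards [hX r hr.le] with ω hω _ using hω
    · exact Eventually.of_forall fun ω h => absurd h hr
  filter_upwards [hX', hXk, hW] with ω hXω hcω hWω T
  obtain ⟨C, hC⟩ := exists_bound_of_isBesselPath hφ hWω hk₀ T
  refine ⟨C, fun k hk t ht => ?_⟩
  have hcont : ContinuousOn (fun k : ℝ => √k * ‖X k t ω - √k • φ t - W t ω‖) (Set.Ici k₀) := by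
    have := hcω t
    fun_prop
  -- Rationals strictly above k₀ accumulate at every k ≥ k₀, including k₀ itself, and the bound `C`
  -- does not depend on them.
  have hmem : k ∈ closure (Set.Ioi k₀ ∩ Set.range ((↑) : ℚ → ℝ)) := by
    refine closure_minimal (Rat.isDenseEmbedding_coe_real.dense.open_subset_closure_inter
      isOpen_Ioi) isClosed_closure ?_
    rw [closure_Ioi]
    exact hk
  have hsub : Set.Ioi k₀ ∩ Set.range ((↑) : ℚ → ℝ) ⊆ Set.Ici k₀ :=
    Set.inter_subset_left.trans Set.Ioi_subset_Ici_self
  have : (𝓝[Set.Ioi k₀ ∩ Set.range ((↑) : ℚ → ℝ)] k).NeBot :=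
    mem_closure_iff_nhdsWithin_neBot.1 hmem
  refine le_of_tendsto ((hcont k hk).mono hsub) ?_
  filter_upwards [self_mem_nhdsWithin] with r hr
  obtain ⟨hr0, q, rfl⟩ := hr
  exact hC q (le_of_lt hr0) _ (hXω q hr0) t ht

end BesselA

theorem theorem2p2 {N : ℕ} {Ω : Type*} [MeasurableSpace Ω] (P : Measure Ω) [IsProbabilityMeasure P]
    (B : ℝ≥0 → Ω → EuclideanSpace ℝ (Fin N)) (hB : BesselA.IsBrownian B P)
    (x y : EuclideanSpace ℝ (Fin N)) (hx : x ∈ interior (BesselA.weylChamber N))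
    (k₀ : ℝ) (hk₀ : 1 / 2 ≤ k₀)
    (hstart : ∀ k : ℝ, k₀ ≤ k → √k • x + y ∈ interior (BesselA.weylChamber N))
    (φ : ℝ → EuclideanSpace ℝ (Fin N)) (hφ : BesselA.IsLimitFlow x φ)
    (X : ℝ → ℝ≥0 → Ω → EuclideanSpace ℝ (Fin N))
    (hX : ∀ k : ℝ, k₀ ≤ k →
      ∀ᵐ ω ∂P, BesselA.IsBesselPath k (√k • x + y) (fun t => B t ω) (fun t => X k t ω))
    (hXk : ∀ᵐ ω ∂P, ∀ t : ℝ≥0, ContinuousOn (fun k : ℝ => X k t ω) (Set.Ici k₀))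
    (W : ℝ≥0 → Ω → EuclideanSpace ℝ (Fin N))
    (hW : ∀ᵐ ω ∂P, BesselA.IsLinearPath φ y (fun t => B t ω) (fun t => W t ω)) :
    (∀ t : ℝ≥0, 0 < t → ∀ᵐ ω ∂P,
      BddAbove {r : ℝ | ∃ s : ℝ≥0, ∃ k : ℝ, s ≤ t ∧ k₀ ≤ k ∧
        r = √k * ‖X k s ω - √k • φ s - W s ω‖}) ∧
    (∀ᵐ ω ∂P,
      TendstoLocallyUniformly
        (fun (k : ℝ) (t : ℝ≥0) => √k • ((√k)⁻¹ • X k t ω - φ t)) (fun t => W t ω) atTop ∧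
      ∀ t : ℝ≥0, 0 < t → ∃ C : ℝ, ∀ k : ℝ, k₀ ≤ k → ∀ s : ℝ≥0, s ≤ t →
        ‖√k • ((√k)⁻¹ • X k s ω - φ s) - W s ω‖ ≤ C / √k) := by
  have hk₀pos : 0 < k₀ := by linarith
  have hmain := BesselA.ae_forall_exists_bound hk₀pos hφ hX hXk hW
  refine ⟨fun t _ => ?_, ?_⟩
  · filter_upwards [hmain] with ω hω
    obtain ⟨C, hC⟩ := hω t
    refine ⟨C, ?_⟩
    rintro r ⟨s, k, hs, hk, rfl⟩
    exact hC k hk s hs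
  · filter_upwards [hmain] with ω hω
    have hrate : ∀ t : ℝ≥0, ∃ C : ℝ, ∀ k : ℝ, k₀ ≤ k → ∀ s : ℝ≥0, s ≤ t →
        ‖√k • ((√k)⁻¹ • X k s ω - φ s) - W s ω‖ ≤ C / √k := by
      intro t
      obtain ⟨C, hC⟩ := hω t
      refine ⟨C, fun k hk s hs => ?_⟩
      have hpos : 0 < √k := Real.sqrt_pos.2 (hk₀pos.trans_le hk)
      rw [smul_sub, smul_inv_smul₀ hpos.ne', le_div_iff₀ hpos, mul_comm]
      exact hC k hk s hs
    refine ⟨?_, fun t _ => hrate t⟩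
    rw [Metric.tendstoLocallyUniformly_iff]
    intro ε hε t
    obtain ⟨C, hC⟩ := hrate (t + 1)
    refine ⟨Set.Iic (t + 1), Iic_mem_nhds (lt_add_one t), ?_⟩
    have hlim : Tendsto (fun k : ℝ => C / √k) atTop (𝓝 0) :=
      tendsto_const_nhds.div_atTop Real.tendsto_sqrt_atTop
    filter_upwards [hlim.eventually_lt_const hε, eventually_ge_atTop k₀] with k hk hk0 s hs
    rw [dist_comm, dist_eq_norm]
    exact (hC k hk0 s hs).trans_lt hk
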